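/- Let $G$ be a finite simple graph. A rectilinear drawing of $G$ places the vertices at distinct points of the plane, no three collinear, and draws every edge as the straight-line segment joining its endpoints; its crossing number $\operatorname{cr}$ is the number of unordered pairs of distinct edges whose relative interiors intersect. Let $D$ be a rectilinear drawing of $G$. For every vertex $v$ let $\ell_v$ be a directed straight line that passes through $v$ and through no other vertex of $D$, and has exactly $\lfloor d(v)/2\rfloor$ neighbours of $v$ in its open left halfplane and the remaining $\lceil d(v)/2\rceil$ neighbours of $v$ in its open right halfplane, where $d(v)$ is the degree of $v$. Let $s\ge 0$ be an integer, and let $G^s$ be the graph with vertices $(v,i)$, $v\in V(G)$, $1\le i\le s$, in which $(v,i)$ and $(w,j)$ are adjacent if and only if $vw$ is an edge of $G$. For $\varepsilon>0$, call a rectilinear drawing of $G^s$ $\varepsilon$-planted (with seed $D$ and lines $\ell_v$) if, for all $v$ and $i$, the point of $(v,i)$ is at distance less than $\varepsilon$ from the point of $v$ in $D$, and, for all $j\ne i$, its distance to $\ell_v$ is less than $\varepsilon$ times its distance to the point of $(v,j)$. Then for every $\varepsilon>0$ an $\varepsilon$-planted drawing of $G^s$ exists, and there is an $\varepsilon>0$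 such that every $\varepsilon$-planted drawing $D^s$ of $G^s$ satisfies $$\operatorname{cr}(D^s)=\operatorname{cr}(D)\,s^4+\sum_{v\in V(G)}\left(\binom{\lfloor d(v)/2\rfloor}{2}+\binom{\lceil d(v)/2\rceil}{2}\right)\frac{s^3(s-1)}{2}+\|G\|\,\frac{s^2(s-1)^2}{4},$$ where $\|G\|$ is the number of edges of $G$, and $\binom{n}{m}=0$ when $n<m$. -/

import Mathlib

/-- The Euclidean plane. -/
abbrev Plane : Type := EuclideanSpace ℝ (Fin 2)

/-- A rectilinear drawing of `G`: the vertices are placed at distinct points of the plane in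
general position (no three of them collinear). Every edge is drawn as the straight-line segment
joining the points of its two endpoints, so the drawing is determined by the vertex positions. -/
structure RectilinearDrawing {V : Type*} (G : SimpleGraph V) where
  pos : V → Plane
  pos_injective : Function.Injective pos
  not_collinear : ∀ a b c : V, a ≠ b → a ≠ c → b ≠ c →
    ¬ Collinear ℝ ({pos a, pos b, pos c} : Set Plane)

namespace RectilinearDrawing

variable {V : Type*} {G : SimpleGraph V}

/-- The interior (endpoints removed) of the segment representing `e` in the drawing. -/
def edgeInterior (D : RectilinearDrawing G) (e : Sym2 V) : Set Plane :=
  {x | ∃ a b : V, e = s(a, b) ∧ x ∈ openSegment ℝ (D.pos a) (D.pos b)}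

/-- Two edges cross if the interiors of the segments representing them meet. -/
def Cross (D : RectilinearDrawing G) (e f : Sym2 V) : Prop :=
  (D.edgeInterior e ∩ D.edgeInterior f).Nonempty

/-- The crossing number of a drawing: the number of unordered pairs of distinct edges
that cross. -/
noncomputable def cr (D : RectilinearDrawing G) : ℕ :=
  Set.ncard {P : Sym2 (Sym2 V) | ∃ e f : Sym2 V, P = s(e, f) ∧
    e ∈ G.edgeSet ∧ f ∈ G.edgeSet ∧ e ≠ f ∧ D.Cross e f}

end RectilinearDrawing

/-- A directed straight line in the plane, given by a base point and a nonzero direction. -/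
structure DirectedLine where
  base : Plane
  dir : Plane
  dir_ne_zero : dir ≠ 0

namespace DirectedLine

/-- The points of the line. -/
def carrier (l : DirectedLine) : Set Plane :=
  {x | ∃ t : ℝ, x = l.base + t • l.dir}

/-- The determinant of the pair (direction of `l`, `x` minus the base point); it is positive to
the left of `l`, zero on `l`, and negative to the right of `l`. -/
def side (l : DirectedLine) (x : Plane) : ℝ :=
  l.dir 0 * (x 1 - l.base 1) - l.dir 1 * (x 0 - l.base 0)

/-- The open halfplane to the left of the line. -/
def left (l : DirectedLine) : Set Plane := {x | 0 < l.side x}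

/-- The open halfplane to the right of the line. -/
def right (l : DirectedLine) : Set Plane := {x | l.side x < 0}

end DirectedLine

/-- `l` is a halving line at the vertex `v` of the drawing `D`: it passes through `v` and through
no other vertex of `D`, it has `⌊d(v)/2⌋` neighbours of `v` on its left and the remaining
`⌈d(v)/2⌉` neighbours of `v` on its right. -/
structure IsHalvingLine {V : Type*} [Fintype V] {G : SimpleGraph V} [DecidableRel G.Adj]
    (D : RectilinearDrawing G) (v : V) (l : DirectedLine) : Prop where
  mem : D.pos v ∈ l.carrier
  notMem : ∀ w : V, w ≠ v → D.pos w ∉ l.carrier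
  left_card : Set.ncard {w : V | G.Adj v w ∧ D.pos w ∈ l.left} = G.degree v / 2
  right_card : Set.ncard {w : V | G.Adj v w ∧ D.pos w ∈ l.right} = (G.degree v + 1) / 2

/-- The graph `G^s`: its vertices are the pairs `(v, i)` with `v` a vertex of `G` and `i` one of
`s` indices, and `(v, i)` is adjacent to `(w, j)` exactly when `vw` is an edge of `G`. -/
def clusterGraph {V : Type*} (G : SimpleGraph V) (s : ℕ) : SimpleGraph (V × Fin s) where
  Adj a b := G.Adj a.1 b.1
  symm := ⟨fun _ _ h => G.adj_symm h⟩
  loopless := ⟨fun a h => G.loopless.irrefl a.1 h⟩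

/-- `D'` is a planted drawing of `G^s` with seed `D` and lines `l`, up to the tolerance `ε`: every
vertex of the cluster of `v` is at distance less than `ε` from `v`, and its distance to the line
`l v` is less than `ε` times its distance to any other vertex of its cluster (the
cluster is flattened onto `l v` at its own scale, not merely shrunk towards `v`). -/
structure IsPlantedWithin {V : Type*} {G : SimpleGraph V} {s : ℕ}
    (D : RectilinearDrawing G) (l : V → DirectedLine) (ε : ℝ)
    (D' : RectilinearDrawing (clusterGraph G s)) : Prop where
  close_to_vertex : ∀ (v : V) (i : Fin s), dist (D'.pos (v, i)) (D.pos v) < ε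
  close_to_line : ∀ (v : V) (i j : Fin s), i ≠ j →
    Metric.infDist (D'.pos (v, i)) (l v).carrier < ε * dist (D'.pos (v, i)) (D'.pos (v, j))

/-! In general position, whether two segments cross depends only on the signs of `orient` on triples
of endpoints, so it suffices to know these signs for small `ε`. Three points from different clusters
are oriented as in the seed, by continuity. For two points of the cluster of `v` and one of another
cluster `w`, flatness makes the line through the two nearly parallel to `l v`, so the sign is
decided by their order along `l v` and the side of `l v` on which `w` lies
(`eventually_isFlatlyPlanted`).

Pairs of edges of `G^s` then fall into three kinds. Over two disjoint seed edges, each seed crossing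
gives `s^4` crossings. Over two seed edges `vw`, `vu`, crossings occur only if `w` and `u` lie on
the same side of `l v`, and then for exactly one order of each two copies of `v`. Over a single seed
edge, crossing is a relation between the orders in the two clusters that holds for half of the
choices. `IsFlatlyPlanted.sum_crossPair` collects these counts over ordered quadruples of seed
vertices; `eight_mul_cr` converts them to crossing numbers.

Existence is separate: equally spaced points on the lines are perturbed into general position. -/

/-! ### Orientations and crossing segments. -/

/-- Twice the signed area of the triangle `p q r`. -/
def orient (p q r : Plane) : ℝ :=
  (q 0 - p 0) * (r 1 - p 1) - (q 1 - p 1) * (r 0 - p 0)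

theorem collinear_of_orient_eq_zero {p q r : Plane} (h : orient p q r = 0) :
    Collinear ℝ ({p, q, r} : Set Plane) := by
  by_cases hpq : p = q
  · subst hpq
    simpa using collinear_pair ℝ p r
  rw [collinear_iff_of_mem (p₀ := p) (by simp)]
  refine ⟨q - p, ?_⟩
  have hn : (q 0 - p 0) ^ 2 + (q 1 - p 1) ^ 2 ≠ 0 := by
    intro h0
    apply hpq
    ext i
    have h1 : (q 0 - p 0) ^ 2 = 0 := by nlinarith [sq_nonneg (q 0 - p 0), sq_nonneg (q 1 - p 1)]
    have h2 : (q 1 - p 1) ^ 2 = 0 := by nlinarith [sq_nonneg (q 0 - p 0), sq_nonneg (q 1 - p 1)]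
    fin_cases i
    · exact (sub_eq_zero.1 (pow_eq_zero_iff two_ne_zero |>.1 h1)).symm
    · exact (sub_eq_zero.1 (pow_eq_zero_iff two_ne_zero |>.1 h2)).symm
  rintro x (rfl | rfl | rfl)
  · exact ⟨0, by simp⟩
  · exact ⟨1, by simp⟩
  · refine ⟨((q 0 - p 0) * (x 0 - p 0) + (q 1 - p 1) * (x 1 - p 1)) /
      ((q 0 - p 0) ^ 2 + (q 1 - p 1) ^ 2), ?_⟩
    unfold orient at h
    ext i
    fin_cases i
    · simp
      field_simp
      linear_combination (-(q 1 - p 1)) * h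
    · simp
      field_simp
      linear_combination (q 0 - p 0) * h

theorem RectilinearDrawing.orient_ne_zero {V : Type*} {G : SimpleGraph V}
    (D : RectilinearDrawing G) {a b c : V} (hab : a ≠ b) (hac : a ≠ c) (hbc : b ≠ c) :
    orient (D.pos a) (D.pos b) (D.pos c) ≠ 0 := fun h =>
  D.not_collinear a b c hab hac hbc (collinear_of_orient_eq_zero h)

/-- Each segment must strictly separate the endpoints of the other. The affine function `orient p q`
vanishes at a common point, which is a positive combination of `r` and `t`; a nonzero value at `r`
thus forces the opposite sign at `t`. The hypotheses exclude collinear overlaps. -/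
theorem openSegment_inter_nonempty_iff {p q r t : Plane} (h1 : orient p q r ≠ 0)
    (h2 : orient r t p ≠ 0) :
    (openSegment ℝ p q ∩ openSegment ℝ r t).Nonempty ↔
      orient p q r * orient p q t < 0 ∧ orient r t p * orient r t q < 0 := by
  constructor
  · rintro ⟨x, ⟨a, b, ha, hb, hab, rfl⟩, ⟨c, d, hc, hd, hcd, hx⟩⟩
    have e0 := congrArg (fun y : Plane => y 0) hx
    have e1 := congrArg (fun y : Plane => y 1) hx
    simp at e0 e1
    obtain rfl : a = 1 - b := by linarith
    obtain rfl : c = 1 - d := by linarith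
    have k1 : (1 - d) * orient p q r + d * orient p q t = 0 := by
      unfold orient
      linear_combination (q 0 - p 0) * e1 - (q 1 - p 1) * e0
    have k2 : (1 - b) * orient r t p + b * orient r t q = 0 := by
      unfold orient
      linear_combination (t 1 - r 1) * e0 - (t 0 - r 0) * e1
    constructor
    · have := mul_pos hc (sq_pos_of_ne_zero h1)
      have e : d * (orient p q r * orient p q t) = -((1 - d) * orient p q r ^ 2) := by
        linear_combination orient p q r * k1
      by_contra hcon
      have := mul_nonneg hd.le (not_lt.1 hcon)
      linarith
    · have := mul_pos ha (sq_pos_of_ne_zero h2)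
      have e : b * (orient r t p * orient r t q) = -((1 - b) * orient r t p ^ 2) := by
        linear_combination orient r t p * k2
      by_contra hcon
      have := mul_nonneg hb.le (not_lt.1 hcon)
      linarith
  · rintro ⟨g1, g2⟩
    have key : ∀ A B : ℝ, A * B < 0 → 0 < A / (A - B) ∧ 0 < -B / (A - B) ∧ A - B ≠ 0 := by
      intro A B hAB
      rcases mul_neg_iff.1 hAB with ⟨hA, hB⟩ | ⟨hA, hB⟩
      · exact ⟨div_pos hA (by linarith), div_pos (by linarith) (by linarith), by linarith⟩
      · refine ⟨div_pos_of_neg_of_neg hA (by linarith),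
          div_pos_of_neg_of_neg (by linarith) (by linarith), by linarith⟩
    obtain ⟨a1, a2, a3⟩ := key _ _ g1
    obtain ⟨b1, b2, b3⟩ := key _ _ g2
    -- The weights are those for which `orient r t` vanishes on `pq`, and `orient p q` on `rt`; the
    -- identities below show that the two points agree.
    refine ⟨(-orient r t q / (orient r t p - orient r t q)) • p +
      (orient r t p / (orient r t p - orient r t q)) • q,
      ⟨_, _, b2, b1, by field_simp; ring, rfl⟩, ⟨_, _, a2, a1, by field_simp; ring, ?_⟩⟩
    have hs : orient p q r - orient p q t = -(orient r t p - orient r t q) := by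
      unfold orient; ring
    have h0 : orient p q r * t 0 - orient p q t * r 0 =
        orient r t q * p 0 - orient r t p * q 0 := by
      unfold orient; ring
    have h1 : orient p q r * t 1 - orient p q t * r 1 =
        orient r t q * p 1 - orient r t p * q 1 := by
      unfold orient; ring
    rw [hs]
    generalize orient r t p - orient r t q = E at b3 ⊢
    ext i
    fin_cases i
    · simp
      field_simp
      linear_combination -h0
    · simp
      field_simp
      linear_combination -h1

theorem openSegment_inter_eq_empty {p q r : Plane} (h : orient p q r ≠ 0) :
    ¬ (openSegment ℝ p q ∩ openSegment ℝ p r).Nonempty := by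
  rintro ⟨x, ⟨a, b, ha, hb, hab, rfl⟩, ⟨c, d, hc, hd, hcd, hx⟩⟩
  have e0 := congrArg (fun y : Plane => y 0) hx
  have e1 := congrArg (fun y : Plane => y 1) hx
  simp at e0 e1
  obtain rfl : a = 1 - b := by linarith
  obtain rfl : c = 1 - d := by linarith
  apply h
  have : d * orient p q r = 0 := by
    unfold orient
    linear_combination (q 0 - p 0) * e1 - (q 1 - p 1) * e0
  exact (mul_eq_zero.1 this).resolve_left hd.ne'

theorem RectilinearDrawing.cross_mk_iff {V : Type*} {G : SimpleGraph V}
    (D : RectilinearDrawing G) (a b c d : V) :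
    D.Cross s(a, b) s(c, d) ↔
      (openSegment ℝ (D.pos a) (D.pos b) ∩ openSegment ℝ (D.pos c) (D.pos d)).Nonempty := by
  have key : ∀ a b : V, D.edgeInterior s(a, b) = openSegment ℝ (D.pos a) (D.pos b) := by
    intro a b
    ext x
    constructor
    · rintro ⟨a', b', h, hx⟩
      rcases Sym2.eq_iff.1 h with ⟨rfl, rfl⟩ | ⟨rfl, rfl⟩
      · exact hx
      · rwa [openSegment_symm]
    · exact fun hx => ⟨a, b, rfl, hx⟩
  rw [RectilinearDrawing.Cross, key, key]

theorem RectilinearDrawing.cross_mk_iff_orient {V : Type*} {G : SimpleGraph V}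
    (D : RectilinearDrawing G) {a b c d : V} (hab : a ≠ b) (hac : a ≠ c) (had : a ≠ d)
    (hbc : b ≠ c) (hcd : c ≠ d) :
    D.Cross s(a, b) s(c, d) ↔
      orient (D.pos a) (D.pos b) (D.pos c) * orient (D.pos a) (D.pos b) (D.pos d) < 0 ∧
      orient (D.pos c) (D.pos d) (D.pos a) * orient (D.pos c) (D.pos d) (D.pos b) < 0 := by
  rw [D.cross_mk_iff, openSegment_inter_nonempty_iff (D.orient_ne_zero hab hac hbc)
    (D.orient_ne_zero hcd hac.symm had.symm)]

theorem RectilinearDrawing.not_cross_of_common_endpoint {V : Type*} {G : SimpleGraph V}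
    (D : RectilinearDrawing G) {a b c : V} (hab : a ≠ b) (hac : a ≠ c) (hbc : b ≠ c) :
    ¬ D.Cross s(a, b) s(a, c) := by
  rw [D.cross_mk_iff]
  exact openSegment_inter_eq_empty (D.orient_ne_zero hab hac hbc)

theorem RectilinearDrawing.Cross.symm {V : Type*} {G : SimpleGraph V}
    {D : RectilinearDrawing G} {e f : Sym2 V} (h : D.Cross e f) : D.Cross f e := by
  unfold RectilinearDrawing.Cross at *
  rwa [Set.inter_comm]

/-! ### Signs of orientations for small tolerance. -/

open Filter Topology in
theorem eventually_orient_mul_pos {p q r : Plane} (h : orient p q r ≠ 0) :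
    ∀ᶠ ε : ℝ in 𝓝[>] 0, ∀ p' q' r' : Plane, dist p' p < ε → dist q' q < ε → dist r' r < ε →
      0 < orient p' q' r' * orient p q r := by
  have hc : Continuous fun x : Plane × Plane × Plane =>
      orient x.1 x.2.1 x.2.2 * orient p q r := by
    unfold orient; fun_prop
  have h0 : 0 < orient p q r * orient p q r := mul_self_pos.2 h
  obtain ⟨δ, hδ, H⟩ := Metric.eventually_nhds_iff.1
    (continuousAt_const.eventually_lt (hc.continuousAt (x := (p, q, r))) h0)
  filter_upwards [Ioo_mem_nhdsGT hδ] with ε hε p' q' r' hp hq hr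
  refine H (y := (p', q', r')) ?_
  simp only [Prod.dist_eq, max_lt_iff]
  exact ⟨hp.trans hε.2, hq.trans hε.2, hr.trans hε.2⟩

namespace DirectedLine

/-- The scalar product of the direction of `l` with `x - p`. -/
def advance (l : DirectedLine) (p x : Plane) : ℝ :=
  l.dir 0 * (x 0 - p 0) + l.dir 1 * (x 1 - p 1)

theorem advance_swap (l : DirectedLine) (p x : Plane) : l.advance x p = -l.advance p x := by
  unfold advance; ring

theorem advance_self (l : DirectedLine) (p : Plane) : l.advance p p = 0 := by
  unfold advance; ring

theorem side_eq_zero_of_mem {l : DirectedLine} {x : Plane} (h : x ∈ l.carrier) :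
    l.side x = 0 := by
  obtain ⟨t, rfl⟩ := h
  unfold side
  simp
  ring

theorem norm_dir_sq (l : DirectedLine) : ‖l.dir‖ ^ 2 = l.dir 0 ^ 2 + l.dir 1 ^ 2 := by
  rw [EuclideanSpace.norm_sq_eq]
  simp [Fin.sum_univ_two]

theorem mem_of_side_eq_zero {l : DirectedLine} {x : Plane} (h : l.side x = 0) :
    x ∈ l.carrier := by
  have hn : l.dir 0 ^ 2 + l.dir 1 ^ 2 ≠ 0 := by
    rw [← norm_dir_sq]
    exact pow_ne_zero _ (norm_ne_zero_iff.2 l.dir_ne_zero)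
  refine ⟨l.advance l.base x / (l.dir 0 ^ 2 + l.dir 1 ^ 2), ?_⟩
  unfold side at h
  unfold advance
  ext i
  fin_cases i
  · simp
    field_simp
    linear_combination (-l.dir 1) * h
  · simp
    field_simp
    linear_combination (l.dir 0) * h

/-- Pythagoras: `advance` and the difference of `side` are coordinates in an orthogonal frame along
`l`, scaled by `‖l.dir‖`. -/
theorem side_sub_sq_add_advance_sq (l : DirectedLine) (x y : Plane) :
    (l.side y - l.side x) ^ 2 + l.advance x y ^ 2 = (‖l.dir‖ * dist x y) ^ 2 := by
  rw [mul_pow, norm_dir_sq, EuclideanSpace.dist_eq, Real.sq_sqrt (by positivity)]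
  simp only [Fin.sum_univ_two, Real.dist_eq, sq_abs]
  unfold side advance
  ring

theorem abs_side_le (l : DirectedLine) (x : Plane) :
    |l.side x| ≤ ‖l.dir‖ * Metric.infDist x l.carrier := by
  have hd : 0 < ‖l.dir‖ := norm_pos_iff.2 l.dir_ne_zero
  have : |l.side x| / ‖l.dir‖ ≤ Metric.infDist x l.carrier := by
    have hne : l.carrier.Nonempty := ⟨l.base, 0, by simp⟩
    refine (Metric.le_infDist hne).2 ?_
    intro y hy
    rw [div_le_iff₀' hd]
    refine abs_le.2 (abs_le_of_sq_le_sq' ?_ (by positivity))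
    have h := l.side_sub_sq_add_advance_sq x y
    rw [side_eq_zero_of_mem hy] at h
    nlinarith [sq_nonneg (l.advance x y)]
  rwa [div_le_iff₀' hd] at this

theorem norm_dir_sq_mul_orient (l : DirectedLine) (p p' q : Plane) :
    ‖l.dir‖ ^ 2 * orient p p' q =
      l.advance p p' * (l.side q - l.side p) - (l.side p' - l.side p) * l.advance p q := by
  rw [norm_dir_sq]
  unfold orient advance side
  ring

end DirectedLine

-- In the frame of `l` the orientation is, up to a positive factor, `X * P - Y * Q`, where `(X, Y)`
-- comes from `p p'` and `(Q, P)` from `p q`. Flatness bounds `Y` by a small multiple of `X`, at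
-- whatever scale the two points lie, and `P` is close to `l.side y`, so `X * P` dominates.
open Filter Topology in
theorem eventually_orient_mul_advance_pos (l : DirectedLine) {x y : Plane} (hx : x ∈ l.carrier)
    (hy : y ∉ l.carrier) :
    ∀ᶠ ε : ℝ in 𝓝[>] 0, ∀ p p' q : Plane, p ≠ p' → dist p x < ε → dist q y < ε →
      Metric.infDist p l.carrier < ε * dist p p' → Metric.infDist p' l.carrier < ε * dist p' p →
      0 < orient p p' q * (l.advance p p' * l.side y) := by
  have hS : l.side y ≠ 0 := fun h => hy (DirectedLine.mem_of_side_eq_zero h)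
  -- The factor `4` combines `|Y| ≤ 2 * ε * N` with `N ≤ 2 * |X|`, which `ε < 1 / 4` guarantees.
  have hc : Continuous fun z : Plane × Plane × ℝ =>
      (l.side z.2.1 - l.side z.1) * l.side y - 4 * z.2.2 * |l.advance z.1 z.2.1| * |l.side y| := by
    unfold DirectedLine.side DirectedLine.advance; fun_prop
  have h0 : 0 < (l.side y - l.side x) * l.side y - 4 * 0 * |l.advance x y| * |l.side y| := by
    rw [DirectedLine.side_eq_zero_of_mem hx]
    have := mul_self_pos.2 hS
    linarith
  obtain ⟨δ, hδ, H⟩ := Metric.eventually_nhds_iff.1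
    (continuousAt_const.eventually_lt (hc.continuousAt (x := (x, y, (0 : ℝ)))) h0)
  filter_upwards [Ioo_mem_nhdsGT hδ, Ioo_mem_nhdsGT (show (0 : ℝ) < 1 / 4 by norm_num)]
    with ε hε hε' p p' q hne hp hq h1 h2
  have K := H (y := (p, q, ε)) (by
    simp only [Prod.dist_eq, max_lt_iff]
    refine ⟨hp.trans hε.2, hq.trans hε.2, ?_⟩
    rw [Real.dist_eq, sub_zero, abs_of_pos hε.1]
    exact hε.2)
  simp only at K
  have hd : 0 < ‖l.dir‖ := norm_pos_iff.2 l.dir_ne_zero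
  have hdist : 0 < dist p p' := dist_pos.2 hne
  have hXY := l.side_sub_sq_add_advance_sq p p'
  have hid := l.norm_dir_sq_mul_orient p p' q
  have hY : |l.side p' - l.side p| ≤ 2 * ε * (‖l.dir‖ * dist p p') := by
    have a1 := l.abs_side_le p
    have a2 := l.abs_side_le p'
    rw [dist_comm p' p] at h2
    have b1 := mul_le_mul_of_nonneg_left h1.le hd.le
    have b2 := mul_le_mul_of_nonneg_left h2.le hd.le
    have := abs_sub (l.side p') (l.side p)
    linarith
  set X := l.advance p p'
  set Y := l.side p' - l.side p
  set P := l.side q - l.side p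
  set Q := l.advance p q
  set S := l.side y
  set N := ‖l.dir‖ * dist p p'
  have hN : 0 < N := mul_pos hd hdist
  have hY2 : Y ^ 2 ≤ 4 * ε ^ 2 * N ^ 2 := by
    rw [← sq_abs]
    calc |Y| ^ 2 ≤ (2 * ε * N) ^ 2 := pow_le_pow_left₀ (abs_nonneg _) hY 2
      _ = _ := by ring
  have hε0 := hε.1
  have hε2 : ε ^ 2 < 1 / 16 := by nlinarith [hε'.2]
  have hX2 : N ^ 2 ≤ 4 * X ^ 2 := by
    have : 0 < N ^ 2 := by positivity
    nlinarith
  have hX : 0 < X ^ 2 := by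
    have : 0 < N ^ 2 := by positivity
    linarith
  have hYX : |Y| ≤ 4 * ε * |X| := by
    refine abs_le.2 (abs_le_of_sq_le_sq' ?_ (by positivity))
    rw [mul_pow, sq_abs]
    nlinarith [mul_le_mul_of_nonneg_left hX2 (sq_nonneg ε)]
  have hfin : 0 < ‖l.dir‖ ^ 2 * (orient p p' q * (X * S)) := by
    have e : ‖l.dir‖ ^ 2 * (orient p p' q * (X * S)) = X ^ 2 * (P * S) - X * Y * Q * S := by
      linear_combination (X * S) * hid
    have b : X * Y * Q * S ≤ X ^ 2 * (4 * ε * |Q| * |S|) := by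
      calc X * Y * Q * S ≤ |X * Y * Q * S| := le_abs_self _
        _ = |X| * |Y| * |Q| * |S| := by simp [abs_mul]
        _ ≤ |X| * (4 * ε * |X|) * |Q| * |S| := by gcongr
        _ = |X| ^ 2 * (4 * ε * |Q| * |S|) := by ring
        _ = _ := by rw [sq_abs]
    have := mul_pos hX K
    rw [e]
    linarith
  exact pos_of_mul_pos_right hfin (by positivity)

/-! ### Counting by sums of indicators. -/

/-- The real-valued indicator of a proposition. -/
noncomputable def ind (p : Prop) : ℝ := open Classical in if p then 1 else 0

theorem ind_of_true {p : Prop} (h : p) : ind p = 1 := if_pos h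

theorem ind_of_false {p : Prop} (h : ¬ p) : ind p = 0 := if_neg h

theorem ind_congr {p q : Prop} (h : p ↔ q) : ind p = ind q := by rw [propext h]

theorem ind_and (p q : Prop) : ind (p ∧ q) = ind p * ind q := by
  by_cases hp : p <;> by_cases hq : q <;> simp [ind, hp, hq]

theorem sum_ind_eq_mul {α : Type*} [Fintype α] (a : α) (f : α → ℝ) :
    ∑ x, ind (a = x) * f x = f a := by
  classical
  rw [Finset.sum_eq_single a]
  · simp [ind]
  · intro b _ hb
    simp [ind, hb.symm]
  · simp

theorem sum_ind_eq_ncard {α : Type*} [Fintype α] (S : Set α) :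
    ∑ x, ind (x ∈ S) = S.ncard := by
  classical
  simp [ind, Set.ncard_eq_toFinset_card', Finset.sum_boole]

theorem sum_sum_sym2_mk {α : Type*} [Fintype α] [DecidableEq α] (h : Sym2 α → ℝ)
    (h0 : ∀ a, h s(a, a) = 0) : ∑ a, ∑ b, h s(a, b) = 2 * ∑ e, h e := by
  rw [← Fintype.sum_prod_type' (f := fun a b => h s(a, b)),
    ← Finset.sum_fiberwise Finset.univ (fun p : α × α => s(p.1, p.2)), Finset.mul_sum]
  refine Finset.sum_congr rfl fun e _ => ?_
  induction e using Sym2.ind with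
  | _ a b =>
    have hc : ∀ p ∈ Finset.univ.filter (fun p : α × α => s(p.1, p.2) = s(a, b)),
        h s(p.1, p.2) = h s(a, b) := by
      intro p hp
      rw [(Finset.mem_filter.1 hp).2]
    rw [Finset.sum_congr rfl hc, Finset.sum_const, nsmul_eq_mul]
    by_cases hab : a = b
    · subst hab
      simp [h0]
    · have : Finset.univ.filter (fun p : α × α => s(p.1, p.2) = s(a, b)) = {(a, b), (b, a)} := by
        ext ⟨x, y⟩
        simp
      rw [this, Finset.card_pair (by simp [hab])]
      norm_num

theorem sum_sum_ind_adj {V : Type*} [Fintype V] (G : SimpleGraph V) :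
    ∑ v, ∑ w, ind (G.Adj v w) = 2 * (G.edgeSet.ncard : ℝ) := by
  classical
  have := sum_sum_sym2_mk (fun e => ind (e ∈ G.edgeSet)) (fun a => ind_of_false (by simp))
  rw [sum_ind_eq_ncard] at this
  simpa using this

namespace RectilinearDrawing

variable {V : Type*} {G : SimpleGraph V}

/-- `ab` and `cd` are distinct edges of the graph that cross in the drawing. -/
def CrossPair (D : RectilinearDrawing G) (a b c d : V) : Prop :=
  G.Adj a b ∧ G.Adj c d ∧ s(a, b) ≠ s(c, d) ∧ D.Cross s(a, b) s(c, d)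

theorem CrossPair.swap_left (D : RectilinearDrawing G) (a b c d : V) :
    D.CrossPair b a c d ↔ D.CrossPair a b c d := by
  unfold CrossPair
  rw [Sym2.eq_swap, G.adj_comm]

theorem CrossPair.swap_right (D : RectilinearDrawing G) (a b c d : V) :
    D.CrossPair a b d c ↔ D.CrossPair a b c d := by
  unfold CrossPair
  rw [Sym2.eq_swap (a := d), G.adj_comm d]

theorem not_crossPair_of_common_endpoint (D : RectilinearDrawing G) (a b c : V) :
    ¬ D.CrossPair a b a c := by
  rintro ⟨hab, hac, hne, hc⟩
  exact D.not_cross_of_common_endpoint hab.ne hac.ne (fun h => hne (h ▸ rfl)) hc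

/-- The factor is `2 * 2 * 2`: two orders of the ends of each edge, and two orders of the edges. -/
theorem eight_mul_cr [Fintype V] (D : RectilinearDrawing G) :
    8 * (D.cr : ℝ) = ∑ a, ∑ b, ∑ c, ∑ d, ind (D.CrossPair a b c d) := by
  classical
  set S := {P : Sym2 (Sym2 V) | ∃ e f : Sym2 V, P = s(e, f) ∧
    e ∈ G.edgeSet ∧ f ∈ G.edgeSet ∧ e ≠ f ∧ D.Cross e f} with hS
  have hmem : ∀ e f, s(e, f) ∈ S ↔ e ∈ G.edgeSet ∧ f ∈ G.edgeSet ∧ e ≠ f ∧ D.Cross e f := by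
    intro e f
    constructor
    · rintro ⟨e', f', h, h1, h2, h3, h4⟩
      rcases Sym2.eq_iff.1 h with ⟨rfl, rfl⟩ | ⟨rfl, rfl⟩
      · exact ⟨h1, h2, h3, h4⟩
      · exact ⟨h2, h1, h3.symm, h4.symm⟩
    · exact fun h => ⟨e, f, rfl, h⟩
  have k1 := sum_sum_sym2_mk (fun P => ind (P ∈ S)) (fun e => ind_of_false fun h =>
    ((hmem e e).1 h).2.2.1 rfl)
  have k2 := sum_sum_sym2_mk (fun e => ∑ f, ind (s(e, f) ∈ S)) (fun a =>
    Finset.sum_eq_zero fun f _ => ind_of_false fun h => by simpa using ((hmem _ _).1 h).1)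
  have k3 : ∀ e, ∑ c, ∑ d, ind (s(e, s(c, d)) ∈ S) = 2 * ∑ f, ind (s(e, f) ∈ S) := fun e =>
    sum_sum_sym2_mk (fun f => ind (s(e, f) ∈ S)) (fun a => ind_of_false fun h => by
      simpa using ((hmem _ _).1 h).2.1)
  rw [sum_ind_eq_ncard] at k1
  have hcr : D.cr = S.ncard := rfl
  have : ∀ a b c d, ind (D.CrossPair a b c d) = ind (s(s(a, b), s(c, d)) ∈ S) := fun a b c d =>
    ind_congr (by rw [hmem]; rfl)
  simp only [this, k3, ← Finset.mul_sum]
  rw [k2, k1, hcr]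
  ring

end RectilinearDrawing

theorem sum_sum_ind_ne (s : ℕ) :
    ∑ i : Fin s, ∑ k : Fin s, ind (i ≠ k) = (s : ℝ) * (s - 1) := by
  have h : ∀ i k : Fin s, ind (i ≠ k) = 1 - ind (i = k) * 1 := by
    intro i k
    by_cases hik : i = k <;> simp [ind, hik]
  simp only [h, Finset.sum_sub_distrib, sum_ind_eq_mul]
  simp
  ring

/-- For `i ≠ k` exactly one of `(i, k)` and `(k, i)` is counted. This is why neither the sign `c`
nor the order of a cluster along its line affects the final count. -/
theorem sum_sum_ind_pos_of_antisymm {s : ℕ} (ρ : Fin s → Fin s → ℝ)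
    (hanti : ∀ i k, ρ k i = -ρ i k) (hne : ∀ i k, i ≠ k → ρ i k ≠ 0) {c : ℝ} (hc : c ≠ 0) :
    ∑ i, ∑ k, ind (0 < c * ρ i k) = (s : ℝ) * (s - 1) / 2 := by
  have h1 : ∑ i, ∑ k, ind (0 < c * ρ i k) = ∑ i, ∑ k, ind (0 < c * ρ k i) := Finset.sum_comm
  have h2 : ∀ i k, ind (0 < c * ρ i k) + ind (0 < c * ρ k i) = ind (i ≠ k) := by
    intro i k
    by_cases hik : i = k
    · subst hik
      have : ρ i i = 0 := by linarith [hanti i i]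
      simp [ind, this]
    · rw [hanti i k, mul_neg, ind_of_true hik]
      rcases lt_or_gt_of_ne (mul_ne_zero hc (hne i k hik)) with h | h
      · rw [ind_of_false h.le.not_gt, ind_of_true (by linarith), zero_add]
      · rw [ind_of_true h, ind_of_false (by linarith), add_zero]
  have h3 := sum_sum_ind_ne s
  simp only [← h2, Finset.sum_add_distrib, ← h1] at h3
  linarith

theorem sum_prod_four {V I : Type*} [Fintype V] [Fintype I]
    (f : V × I → V × I → V × I → V × I → ℝ) :
    ∑ a, ∑ b, ∑ c, ∑ d, f a b c d = ∑ v, ∑ w, ∑ x, ∑ y, ∑ i, ∑ j, ∑ k, ∑ m,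
      f (v, i) (w, j) (x, k) (y, m) := by
  have h2 : ∀ g : V × I → V × I → ℝ,
      ∑ a, ∑ b, g a b = ∑ v, ∑ w, ∑ i, ∑ j, g (v, i) (w, j) := by
    intro g
    simp only [Fintype.sum_prod_type]
    exact Finset.sum_congr rfl fun v _ => Finset.sum_comm
  have h4 : ∀ g : I → I → V → V → ℝ,
      ∑ i, ∑ j, ∑ x, ∑ y, g i j x y = ∑ x, ∑ y, ∑ i, ∑ j, g i j x y := by
    intro g
    calc ∑ i, ∑ j, ∑ x, ∑ y, g i j x y = ∑ i, ∑ x, ∑ j, ∑ y, g i j x y :=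
          Finset.sum_congr rfl fun i _ => Finset.sum_comm
      _ = ∑ x, ∑ i, ∑ y, ∑ j, g i j x y := by
          rw [Finset.sum_comm]
          exact Finset.sum_congr rfl fun x _ => Finset.sum_congr rfl fun i _ => Finset.sum_comm
      _ = _ := Finset.sum_congr rfl fun x _ => Finset.sum_comm
  rw [h2]
  refine Finset.sum_congr rfl fun v _ => Finset.sum_congr rfl fun w _ => ?_
  rw [← h4]
  exact Finset.sum_congr rfl fun i _ => Finset.sum_congr rfl fun j _ => h2 _

/-! ### Crossing criteria in a flatly planted drawing. -/

/-- The orientations of the triples of points from at least two clusters are those of a flat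
planted drawing: triples from three clusters are oriented as in the seed, and two points of a
cluster are ordered along its line. -/
structure IsFlatlyPlanted {V : Type*} {G : SimpleGraph V} {s : ℕ}
    (D : RectilinearDrawing G) (l : V → DirectedLine)
    (D' : RectilinearDrawing (clusterGraph G s)) : Prop where
  orient_three : ∀ u v w : V, u ≠ v → u ≠ w → v ≠ w → ∀ i j k : Fin s,
    0 < orient (D'.pos (u, i)) (D'.pos (v, j)) (D'.pos (w, k)) *
      orient (D.pos u) (D.pos v) (D.pos w)
  orient_two : ∀ v w : V, v ≠ w → ∀ i i' k : Fin s, i ≠ i' →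
    0 < orient (D'.pos (v, i)) (D'.pos (v, i')) (D'.pos (w, k)) *
      ((l v).advance (D'.pos (v, i)) (D'.pos (v, i')) * (l v).side (D.pos w))

open Filter Topology in
theorem eventually_isFlatlyPlanted {V : Type*} [Finite V] {G : SimpleGraph V}
    (D : RectilinearDrawing G) (l : V → DirectedLine) (hmem : ∀ v, D.pos v ∈ (l v).carrier)
    (hnot : ∀ v w, w ≠ v → D.pos w ∉ (l v).carrier) (s : ℕ) :
    ∀ᶠ ε : ℝ in 𝓝[>] 0, ∀ D' : RectilinearDrawing (clusterGraph G s),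
      IsPlantedWithin D l ε D' → IsFlatlyPlanted D l D' := by
  have h1 : ∀ u v w : V, ∀ᶠ ε : ℝ in 𝓝[>] 0, u ≠ v → u ≠ w → v ≠ w →
      ∀ p' q' r' : Plane, dist p' (D.pos u) < ε → dist q' (D.pos v) < ε →
      dist r' (D.pos w) < ε →
      0 < orient p' q' r' * orient (D.pos u) (D.pos v) (D.pos w) := by
    intro u v w
    by_cases h : u ≠ v ∧ u ≠ w ∧ v ≠ w
    · filter_upwards [eventually_orient_mul_pos (D.orient_ne_zero h.1 h.2.1 h.2.2)] with ε hε
        _ _ _ using hε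
    · exact Eventually.of_forall fun ε a b c => (h ⟨a, b, c⟩).elim
  have h2 : ∀ v w : V, ∀ᶠ ε : ℝ in 𝓝[>] 0, v ≠ w → ∀ p p' q : Plane, p ≠ p' →
      dist p (D.pos v) < ε → dist q (D.pos w) < ε →
      Metric.infDist p (l v).carrier < ε * dist p p' →
      Metric.infDist p' (l v).carrier < ε * dist p' p →
      0 < orient p p' q * ((l v).advance p p' * (l v).side (D.pos w)) := by
    intro v w
    by_cases h : v = w
    · exact Eventually.of_forall fun ε a => (a h).elim
    · filter_upwards [eventually_orient_mul_advance_pos (l v) (hmem v)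
        (hnot v w (Ne.symm h))] with ε hε _ using hε
  have h1' := eventually_all.2 fun u => eventually_all.2 fun v => eventually_all.2 (h1 u v)
  have h2' := eventually_all.2 fun v => eventually_all.2 (h2 v)
  filter_upwards [h1', h2'] with ε k1 k2 D' hD'
  refine ⟨fun u v w huv huw hvw i j k => k1 u v w huv huw hvw _ _ _ (hD'.close_to_vertex u i)
    (hD'.close_to_vertex v j) (hD'.close_to_vertex w k), fun v w hvw i i' k hi => ?_⟩
  exact k2 v w hvw _ _ _ (fun h => hi (Prod.ext_iff.1 (D'.pos_injective h)).2)
    (hD'.close_to_vertex v i) (hD'.close_to_vertex w k) (hD'.close_to_line v i i' hi)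
    (hD'.close_to_line v i' i hi.symm)

theorem pos_mul_iff_of_mul_pos {A B a b : ℝ} (h : 0 < A * a) (h' : 0 < B * b) :
    0 < A * B ↔ 0 < a * b :=
  pos_iff_pos_of_mul_pos (by nlinarith [mul_pos h h'])

namespace IsFlatlyPlanted

variable {V : Type*} {G : SimpleGraph V} {s : ℕ} {D : RectilinearDrawing G}
  {l : V → DirectedLine} {D' : RectilinearDrawing (clusterGraph G s)}

theorem advance_ne_zero (h : IsFlatlyPlanted D l D') {v w : V} (hvw : v ≠ w) {i i' : Fin s}
    (hi : i ≠ i') : (l v).advance (D'.pos (v, i)) (D'.pos (v, i')) ≠ 0 := fun h0 => by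
  simpa [h0] using h.orient_two v w hvw i i' i hi

theorem side_ne_zero (h : IsFlatlyPlanted D l D') {v w : V} (hvw : v ≠ w) {i i' : Fin s}
    (hi : i ≠ i') : (l v).side (D.pos w) ≠ 0 := fun h0 => by
  simpa [h0] using h.orient_two v w hvw i i' i hi

theorem crossPair_parallel_iff (h : IsFlatlyPlanted D l D') {v w : V} (hvw : G.Adj v w)
    (i j k m : Fin s) :
    D'.CrossPair (v, i) (w, j) (v, k) (w, m) ↔
      0 < (l v).side (D.pos w) * (l w).side (D.pos v) *
        (l v).advance (D'.pos (v, i)) (D'.pos (v, k)) *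
        (l w).advance (D'.pos (w, j)) (D'.pos (w, m)) := by
  have hne := hvw.ne
  by_cases hik : i = k
  · subst hik
    rw [DirectedLine.advance_self]
    simp [D'.not_crossPair_of_common_endpoint]
  by_cases hjm : j = m
  · subst hjm
    rw [DirectedLine.advance_self, ← RectilinearDrawing.CrossPair.swap_left,
      ← RectilinearDrawing.CrossPair.swap_right]
    simp [D'.not_crossPair_of_common_endpoint]
  have a1 := h.orient_two v w hne i k j hik
  have a2 := h.orient_two v w hne i k m hik
  have b1 := h.orient_two w v hne.symm j m i hjm
  have b2 := h.orient_two w v hne.symm j m k hjm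
  have c1 := pos_mul_iff_of_mul_pos a1 b1
  have c2 := pos_mul_iff_of_mul_pos a2 b2
  have e1 : orient (D'.pos (v, i)) (D'.pos (w, j)) (D'.pos (v, k)) =
      -orient (D'.pos (v, i)) (D'.pos (v, k)) (D'.pos (w, j)) := by unfold orient; ring
  have e2 : orient (D'.pos (v, i)) (D'.pos (w, j)) (D'.pos (w, m)) =
      orient (D'.pos (w, j)) (D'.pos (w, m)) (D'.pos (v, i)) := by unfold orient; ring
  have e3 : orient (D'.pos (v, k)) (D'.pos (w, m)) (D'.pos (v, i)) =
      orient (D'.pos (v, i)) (D'.pos (v, k)) (D'.pos (w, m)) := by unfold orient; ring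
  have e4 : orient (D'.pos (v, k)) (D'.pos (w, m)) (D'.pos (w, j)) =
      -orient (D'.pos (w, j)) (D'.pos (w, m)) (D'.pos (v, k)) := by unfold orient; ring
  have hcross := D'.cross_mk_iff_orient (a := (v, i)) (b := (w, j)) (c := (v, k)) (d := (w, m))
    (by simp [hne]) (by simp [hik]) (by simp [hne]) (by simp [hne.symm]) (by simp [hne])
  -- The signs depend only on the pairs `i, k` and `j, m`, so the two separation conditions become
  -- one.
  rw [e1, e2, e3, e4, neg_mul, mul_neg, neg_lt_zero, neg_lt_zero, c1, c2, and_self] at hcross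
  have hE : (l v).side (D.pos w) * (l w).side (D.pos v) *
        (l v).advance (D'.pos (v, i)) (D'.pos (v, k)) *
        (l w).advance (D'.pos (w, j)) (D'.pos (w, m)) =
      (l v).advance (D'.pos (v, i)) (D'.pos (v, k)) * (l v).side (D.pos w) *
        ((l w).advance (D'.pos (w, j)) (D'.pos (w, m)) * (l w).side (D.pos v)) := by ring
  rw [hE, ← hcross]
  refine ⟨fun H => H.2.2.2, fun H => ⟨hvw, hvw, ?_, H⟩⟩
  simp [hik, hne]

/-- With `r` the advance, `a`, `b` the sides of `w`, `u` and `o` the seed orientation, the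
separation conditions read `0 < r * a * o` and `0 < r * b * o`. Together they force `a` and `b` to
have equal sign. -/
theorem crossPair_adjacent_iff (h : IsFlatlyPlanted D l D') {v w u : V} (hvw : G.Adj v w)
    (hvu : G.Adj v u) (hwu : w ≠ u) (i j k m : Fin s) :
    D'.CrossPair (v, i) (w, j) (v, k) (u, m) ↔
      0 < (l v).side (D.pos w) * (l v).side (D.pos u) ∧
      0 < orient (D.pos v) (D.pos w) (D.pos u) * (l v).side (D.pos w) *
        (l v).advance (D'.pos (v, i)) (D'.pos (v, k)) := by
  by_cases hik : i = k
  · subst hik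
    rw [DirectedLine.advance_self]
    simp [D'.not_crossPair_of_common_endpoint]
  have a1 := h.orient_two v w hvw.ne i k j hik
  have a2 := h.orient_two v u hvu.ne i k m hik
  have b1 := h.orient_three v w u hvw.ne hvu.ne hwu i j m
  have b2 := h.orient_three v w u hvw.ne hvu.ne hwu k j m
  have c1 := pos_mul_iff_of_mul_pos a1 b1
  have c2 := pos_mul_iff_of_mul_pos a2 b2
  have e1 : orient (D'.pos (v, i)) (D'.pos (w, j)) (D'.pos (v, k)) =
      -orient (D'.pos (v, i)) (D'.pos (v, k)) (D'.pos (w, j)) := by unfold orient; ring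
  have e3 : orient (D'.pos (v, k)) (D'.pos (u, m)) (D'.pos (v, i)) =
      orient (D'.pos (v, i)) (D'.pos (v, k)) (D'.pos (u, m)) := by unfold orient; ring
  have e4 : orient (D'.pos (v, k)) (D'.pos (u, m)) (D'.pos (w, j)) =
      -orient (D'.pos (v, k)) (D'.pos (w, j)) (D'.pos (u, m)) := by unfold orient; ring
  have hcross := D'.cross_mk_iff_orient (a := (v, i)) (b := (w, j)) (c := (v, k)) (d := (u, m))
    (by simp [hvw.ne]) (by simp [hik]) (by simp [hvu.ne]) (by simp [hvw.ne.symm])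
    (by simp [hvu.ne])
  rw [e1, e3, e4, neg_mul, mul_neg, neg_lt_zero, neg_lt_zero, c1, c2] at hcross
  have hcp : D'.CrossPair (v, i) (w, j) (v, k) (u, m) ↔
      D'.Cross s((v, i), (w, j)) s((v, k), (u, m)) := by
    refine ⟨fun H => H.2.2.2, fun H => ⟨hvw, hvu, ?_, H⟩⟩
    simp [hik, hvu.ne]
  rw [hcp, hcross]
  generalize (l v).advance (D'.pos (v, i)) (D'.pos (v, k)) = r
  generalize (l v).side (D.pos w) = a
  generalize (l v).side (D.pos u) = b
  generalize orient (D.pos v) (D.pos w) (D.pos u) = o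
  have e : r * a * o = o * a * r := by ring
  rw [e, and_comm]
  refine and_congr_left fun H => ?_
  have : 0 < r * b * o * (a * b) ↔ 0 < b ^ 2 := by
    rw [show r * b * o * (a * b) = o * a * r * b ^ 2 by ring]
    exact mul_pos_iff_of_pos_left H
  by_cases hb : b = 0
  · simp [hb]
  · exact pos_iff_pos_of_mul_pos (this.2 (by positivity))

theorem crossPair_disjoint_iff (h : IsFlatlyPlanted D l D') {v w x y : V} (hvw : v ≠ w)
    (hvx : v ≠ x) (hvy : v ≠ y) (hwx : w ≠ x) (hwy : w ≠ y) (hxy : x ≠ y) (i j k m : Fin s) :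
    D'.CrossPair (v, i) (w, j) (x, k) (y, m) ↔ D.CrossPair v w x y := by
  have key : ∀ {A B a b : ℝ}, 0 < A * a → 0 < B * b → (A * B < 0 ↔ a * b < 0) := by
    intro A B a b h1 h2
    have := pos_mul_iff_of_mul_pos (A := -A) (a := -a) (by simpa using h1) h2
    simpa [neg_mul] using this
  have hc := D.cross_mk_iff_orient hvw hvx hvy hwx hxy
  have hc' := D'.cross_mk_iff_orient (a := (v, i)) (b := (w, j)) (c := (x, k)) (d := (y, m))
    (by simp [hvw]) (by simp [hvx]) (by simp [hvy]) (by simp [hwx]) (by simp [hxy])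
  rw [key (h.orient_three v w x hvw hvx hwx i j k) (h.orient_three v w y hvw hvy hwy i j m),
    key (h.orient_three x y v hxy hvx.symm hvy.symm k m i)
      (h.orient_three x y w hxy hwx.symm hwy.symm k m j), ← hc] at hc'
  unfold RectilinearDrawing.CrossPair
  rw [hc']
  simp [clusterGraph, hvx, hvy]

end IsFlatlyPlanted

/-! ### Existence of planted drawings. -/

theorem volume_line_eq_zero (p q : Plane) :
    MeasureTheory.volume (line[ℝ, p, q] : Set Plane) = 0 := by
  apply MeasureTheory.Measure.addHaar_affineSubspace
  intro h
  have h1 := collinear_iff_finrank_le_one.1 (collinear_pair ℝ p q)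
  rw [← direction_affineSpan] at h1
  rw [h, AffineSubspace.direction_top] at h1
  simp at h1

/-- Points in general position can be chosen from prescribed balls. -/
theorem exists_general_position {ι : Type*} [Finite ι] (c : ι → Plane) {η : ℝ} (hη : 0 < η) :
    ∃ f : ι → Plane, (∀ i, dist (f i) (c i) < η) ∧ Function.Injective f ∧
      ∀ i j k, i ≠ j → i ≠ k → j ≠ k → ¬ Collinear ℝ ({f i, f j, f k} : Set Plane) := by
  classical
  have := Fintype.ofFinite ι
  suffices H : ∀ S : Finset ι, ∃ f : ι → Plane, (∀ i, dist (f i) (c i) < η) ∧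
      (∀ i ∈ S, ∀ j ∈ S, i ≠ j → f i ≠ f j) ∧
      ∀ i ∈ S, ∀ j ∈ S, ∀ k ∈ S, i ≠ j → i ≠ k → j ≠ k →
        ¬ Collinear ℝ ({f i, f j, f k} : Set Plane) by
    obtain ⟨f, h1, h2, h3⟩ := H Finset.univ
    refine ⟨f, h1, fun i j hij => ?_, fun i j k => h3 i (by simp) j (by simp) k (by simp)⟩
    by_contra hne
    exact h2 i (by simp) j (by simp) hne hij
  intro S
  induction S using Finset.induction_on with
  | empty => exact ⟨c, by simpa using fun _ => hη, by simp, by simp⟩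
  | insert a S ha ih =>
    obtain ⟨f, h1, h2, h3⟩ := ih
    -- Finitely many lines form a null set, while the ball has positive measure. The degenerate
    -- lines through `f i` and `f i` make `x` differ from every old point.
    obtain ⟨x, hxb, hx⟩ : ∃ x ∈ Metric.ball (c a) η,
        x ∉ ⋃ ij : ι × ι, (line[ℝ, f ij.1, f ij.2] : Set Plane) := by
      by_contra! hcon
      have h0 : MeasureTheory.volume (⋃ ij : ι × ι, (line[ℝ, f ij.1, f ij.2] : Set Plane)) = 0 :=
        MeasureTheory.measure_iUnion_null fun ij => volume_line_eq_zero _ _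
      have := MeasureTheory.measure_mono_null (fun x hx => hcon x hx) h0
      exact (Metric.isOpen_ball.measure_pos MeasureTheory.volume
        ⟨c a, Metric.mem_ball_self hη⟩).ne' this
    have hx' : ∀ i j, x ∉ line[ℝ, f i, f j] := fun i j hij =>
      hx (Set.mem_iUnion.2 ⟨(i, j), hij⟩)
    have hxi : ∀ i, x ≠ f i := fun i h => hx' i i (h ▸ left_mem_affineSpan_pair ℝ _ _)
    have hcol : ∀ i ∈ S, ∀ j ∈ S, i ≠ j → ¬ Collinear ℝ ({x, f i, f j} : Set Plane) := by
      intro i hi j hj hij hc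
      exact hx' i j (hc.mem_affineSpan_of_mem_of_ne (p₁ := f i) (p₂ := f j) (by simp) (by simp)
        (by simp) (h2 i hi j hj hij))
    have hfa : ∀ i ∈ S, Function.update f a x i = f i := fun i hi =>
      Function.update_of_ne (ne_of_mem_of_not_mem hi ha) _ _
    refine ⟨Function.update f a x, fun i => ?_, ?_, ?_⟩
    · by_cases hi : i = a
      · subst hi; simpa using hxb
      · simpa [hi] using h1 i
    · intro i hi j hj hij
      rcases Finset.mem_insert.1 hi with h | hi <;> rcases Finset.mem_insert.1 hj with h' | hj
      · exact absurd (h.trans h'.symm) hij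
      · simpa [h, hfa j hj] using hxi j
      · simpa [h', hfa i hi] using (hxi i).symm
      · simpa [hfa i hi, hfa j hj] using h2 i hi j hj hij
    · intro i hi j hj k hk hij hik hjk
      rcases Finset.mem_insert.1 hi with h | hi
      · have hj := Finset.mem_of_mem_insert_of_ne hj (h ▸ hij.symm)
        have hk := Finset.mem_of_mem_insert_of_ne hk (h ▸ hik.symm)
        simpa [h, hfa j hj, hfa k hk] using hcol j hj k hk hjk
      rcases Finset.mem_insert.1 hj with h | hj
      · have hk := Finset.mem_of_mem_insert_of_ne hk (h ▸ hjk.symm)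
        have := hcol i hi k hk hik
        rw [Set.insert_comm] at this
        simpa [h, hfa i hi, hfa k hk] using this
      rcases Finset.mem_insert.1 hk with h | hk
      · have := hcol i hi j hj hij
        rw [Set.insert_comm, Set.pair_comm] at this
        simpa [h, hfa i hi, hfa j hj] using this
      · simpa [hfa i hi, hfa j hj, hfa k hk] using h3 i hi j hj k hk hij hik hjk

theorem exists_isPlantedWithin {V : Type*} [Finite V] {G : SimpleGraph V}
    (D : RectilinearDrawing G) (l : V → DirectedLine) (hl : ∀ v, D.pos v ∈ (l v).carrier)
    (s : ℕ) {ε : ℝ} (hε : 0 < ε) :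
    ∃ D' : RectilinearDrawing (clusterGraph G s), IsPlantedWithin D l ε D' := by
  -- `m` is the spacing along the line; dividing by `s + 1` covers `s = 0`.
  obtain ⟨m, hm0, hm⟩ : ∃ m : ℝ, 0 < m ∧ (s : ℝ) * m ≤ ε / 2 := by
    refine ⟨ε / 2 / (s + 1), by positivity, ?_⟩
    rw [mul_div_assoc', div_le_iff₀ (by positivity)]
    nlinarith
  -- The last condition says `η ≤ ε * (m - 2 * η)`: perturbing by less than `η` leaves points of a
  -- cluster more than `m - 2 * η` apart.
  obtain ⟨η, hη, hη1, hη2⟩ : ∃ η : ℝ, 0 < η ∧ η ≤ ε / 2 ∧ η * (1 + 2 * ε) ≤ ε * m := by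
    refine ⟨min (ε / 2) (ε * m / (1 + 2 * ε)), by positivity, min_le_left _ _, ?_⟩
    rw [← le_div_iff₀ (by positivity)]
    exact min_le_right _ _
  have hd : ∀ v, 0 < ‖(l v).dir‖ := fun v => norm_pos_iff.2 (l v).dir_ne_zero
  let c : V × Fin s → Plane := fun a =>
    D.pos a.1 + ((a.2 : ℝ) * m / ‖(l a.1).dir‖) • (l a.1).dir
  obtain ⟨f, h1, h2, h3⟩ := exists_general_position c hη
  refine ⟨⟨f, h2, h3⟩, ⟨fun v i => ?_, fun v i j hij => ?_⟩⟩
  · have hc : dist (c (v, i)) (D.pos v) ≤ ε / 2 := by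
      simp only [c, dist_self_add_left, norm_smul, Real.norm_eq_abs]
      rw [abs_of_nonneg (by positivity), div_mul_cancel₀ _ (hd v).ne']
      refine le_trans ?_ hm
      gcongr
      exact_mod_cast i.2.le
    have := dist_triangle (f (v, i)) (c (v, i)) (D.pos v)
    have := h1 (v, i)
    show dist (f (v, i)) _ < ε
    linarith
  · show Metric.infDist (f (v, i)) _ < ε * dist (f (v, i)) (f (v, j))
    have hc : c (v, i) ∈ (l v).carrier := by
      obtain ⟨t, ht⟩ := hl v
      exact ⟨t + (i : ℝ) * m / ‖(l v).dir‖, by simp only [c, ht]; module⟩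
    have a1 := Metric.infDist_le_dist_of_mem (x := f (v, i)) hc
    have a2 := h1 (v, i)
    have a3 := h1 (v, j)
    have a4 : m ≤ dist (c (v, i)) (c (v, j)) := by
      simp only [c]
      rw [dist_add_left, dist_eq_norm, ← sub_smul, norm_smul, Real.norm_eq_abs, ← sub_div, ← sub_mul, abs_div, abs_norm, div_mul_cancel₀ _ (hd v).ne', abs_mul,
        abs_of_pos hm0]
      have : (1 : ℝ) ≤ |((i : ℕ) : ℝ) - ((j : ℕ) : ℝ)| := by
        have : (1 : ℤ) ≤ |((i : ℕ) : ℤ) - ((j : ℕ) : ℤ)| := by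
          apply Int.one_le_abs
          have := Fin.val_ne_of_ne hij
          omega
        exact_mod_cast this
      nlinarith
    have a5 := dist_triangle4 (c (v, i)) (f (v, i)) (f (v, j)) (c (v, j))
    rw [dist_comm (c (v, i)) (f (v, i))] at a5
    have : ε * (m - 2 * η) < ε * dist (f (v, i)) (f (v, j)) := by
      apply mul_lt_mul_of_pos_left _ hε
      linarith
    linarith

/-! ### Counting crossings over each quadruple of seed vertices. -/

namespace IsFlatlyPlanted

variable {V : Type*} {G : SimpleGraph V} {s : ℕ} {D : RectilinearDrawing G}
  {l : V → DirectedLine} {D' : RectilinearDrawing (clusterGraph G s)}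

theorem sum_crossPair_parallel (h : IsFlatlyPlanted D l D') {v w : V} (hvw : G.Adj v w) :
    ∑ i, ∑ j, ∑ k, ∑ m, ind (D'.CrossPair (v, i) (w, j) (v, k) (w, m)) =
      (s : ℝ) ^ 2 * (s - 1) ^ 2 / 2 := by
  have key : ∀ i k, ∑ j, ∑ m, ind (D'.CrossPair (v, i) (w, j) (v, k) (w, m)) =
      ind (i ≠ k) * ((s : ℝ) * (s - 1) / 2) := by
    intro i k
    by_cases hik : i = k
    · subst hik
      rw [ind_of_false (by simp), zero_mul]
      exact Finset.sum_eq_zero fun j _ => Finset.sum_eq_zero fun m _ =>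
        ind_of_false (D'.not_crossPair_of_common_endpoint _ _ _)
    · rw [ind_of_true hik, one_mul]
      simp only [h.crossPair_parallel_iff hvw]
      refine sum_sum_ind_pos_of_antisymm
        (fun j m => (l w).advance (D'.pos (w, j)) (D'.pos (w, m)))
        (fun j m => (l w).advance_swap _ _) (fun j m => h.advance_ne_zero hvw.ne.symm) ?_
      exact mul_ne_zero (mul_ne_zero (h.side_ne_zero hvw.ne hik)
        (h.side_ne_zero hvw.ne.symm hik)) (h.advance_ne_zero hvw.ne hik)
  calc _ = ∑ i, ∑ k, ∑ j, ∑ m, ind (D'.CrossPair (v, i) (w, j) (v, k) (w, m)) :=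
        Finset.sum_congr rfl fun i _ => Finset.sum_comm
    _ = _ := by
        simp only [key, ← Finset.sum_mul, sum_sum_ind_ne]
        ring

theorem sum_crossPair_adjacent (h : IsFlatlyPlanted D l D') {v w u : V} (hvw : G.Adj v w)
    (hvu : G.Adj v u) (hwu : w ≠ u) :
    ∑ i, ∑ j, ∑ k, ∑ m, ind (D'.CrossPair (v, i) (w, j) (v, k) (u, m)) =
      (s : ℝ) ^ 3 * (s - 1) / 2 * ind (0 < (l v).side (D.pos w) * (l v).side (D.pos u)) := by
  simp only [h.crossPair_adjacent_iff hvw hvu hwu]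
  by_cases hp : 0 < (l v).side (D.pos w) * (l v).side (D.pos u)
  · have hc : orient (D.pos v) (D.pos w) (D.pos u) * (l v).side (D.pos w) ≠ 0 :=
      mul_ne_zero (D.orient_ne_zero hvw.ne hvu.ne hwu) (left_ne_zero_of_mul hp.ne')
    have := sum_sum_ind_pos_of_antisymm
      (fun i k => (l v).advance (D'.pos (v, i)) (D'.pos (v, k)))
      (fun i k => (l v).advance_swap _ _) (fun i k => h.advance_ne_zero hvw.ne) hc
    rw [ind_of_true hp]
    simp only [hp, true_and, Finset.sum_const, Finset.card_univ, Fintype.card_fin,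
      nsmul_eq_mul, ← Finset.mul_sum, this]
    ring
  · simp [hp, ind]

theorem sum_crossPair_disjoint (h : IsFlatlyPlanted D l D') {v w x y : V} (hvw : v ≠ w)
    (hvx : v ≠ x) (hvy : v ≠ y) (hwx : w ≠ x) (hwy : w ≠ y) (hxy : x ≠ y) :
    ∑ i, ∑ j, ∑ k, ∑ m, ind (D'.CrossPair (v, i) (w, j) (x, k) (y, m)) =
      (s : ℝ) ^ 4 * ind (D.CrossPair v w x y) := by
  simp only [h.crossPair_disjoint_iff hvw hvx hvy hwx hwy hxy, Finset.sum_const,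
    Finset.card_univ, Fintype.card_fin, nsmul_eq_mul]
  ring

end IsFlatlyPlanted

/-- `w` and `u` are distinct neighbours of `v` on the same side of `l`. -/
def SameSide {V : Type*} {G : SimpleGraph V} (D : RectilinearDrawing G) (l : DirectedLine)
    (v w u : V) : Prop :=
  G.Adj v w ∧ G.Adj v u ∧ w ≠ u ∧ 0 < l.side (D.pos w) * l.side (D.pos u)

theorem sum_sum_ind_sameSide {V : Type*} [Fintype V] {G : SimpleGraph V} [DecidableRel G.Adj]
    (D : RectilinearDrawing G) {l : DirectedLine} {v : V} (hl : IsHalvingLine D v l) :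
    ∑ w, ∑ u, ind (SameSide D l v w u) =
      2 * (((G.degree v / 2).choose 2 : ℝ) + (((G.degree v + 1) / 2).choose 2 : ℝ)) := by
  set L : V → Prop := fun w => w ∈ {w : V | G.Adj v w ∧ D.pos w ∈ l.left} with hL
  set R : V → Prop := fun w => w ∈ {w : V | G.Adj v w ∧ D.pos w ∈ l.right} with hR
  have hLs : ∑ w, ind (L w) = (G.degree v / 2 : ℕ) := by
    rw [← hl.left_card]; exact sum_ind_eq_ncard _
  have hRs : ∑ w, ind (R w) = ((G.degree v + 1) / 2 : ℕ) := by
    rw [← hl.right_card]; exact sum_ind_eq_ncard _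
  -- The subtracted term removes the diagonal `w = u`, so that a side with `n` neighbours
  -- contributes `n ^ 2 - n`, twice `n.choose 2`.
  have key : ∀ w u, ind (SameSide D l v w u) = ind (L w) * ind (L u) + ind (R w) * ind (R u) -
      ind (w = u) * (ind (L u) + ind (R u)) := by
    intro w u
    simp only [hL, hR, SameSide, Set.mem_ofPred_eq, DirectedLine.left, DirectedLine.right]
    by_cases hw : G.Adj v w
    swap
    · by_cases hwu : w = u
      · subst hwu; simp [ind, hw]
      · simp [ind, hw, hwu]
    by_cases hu : G.Adj v u
    swap
    · simp [ind, hu]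
    simp only [hw, hu, true_and]
    by_cases hwu : w = u
    · subst hwu
      rcases lt_trichotomy (l.side (D.pos w)) 0 with h | h | h <;>
        simp [ind, h, h.not_gt]
    · rw [ind_of_false hwu, zero_mul, sub_zero]
      simp only [ne_eq, hwu, not_false_eq_true, true_and, ← ind_and]
      rw [ind_congr mul_pos_iff]
      by_cases h : 0 < l.side (D.pos w) ∧ 0 < l.side (D.pos u)
      · have : ¬ (l.side (D.pos w) < 0 ∧ l.side (D.pos u) < 0) := fun h' => h.1.not_gt h'.1
        simp [ind, h, this]
      · simp [ind, h]
  simp only [key, Finset.sum_sub_distrib, Finset.sum_add_distrib, ← Finset.mul_sum,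
    ← Finset.sum_mul, sum_ind_eq_mul, hLs, hRs, Nat.cast_choose_two]
  ring

/-- The seven terms are the possible coincidences between the ends of the two seed edges, and at
most one is nonzero. Swapping the ends of an edge (`hl`, `hr`) reduces every coincidence to `v = x`.
-/
theorem IsFlatlyPlanted.sum_crossPair {V : Type*} {G : SimpleGraph V} {s : ℕ}
    {D : RectilinearDrawing G} {l : V → DirectedLine}
    {D' : RectilinearDrawing (clusterGraph G s)} (h : IsFlatlyPlanted D l D') (v w x y : V) :
    ∑ i, ∑ j, ∑ k, ∑ m, ind (D'.CrossPair (v, i) (w, j) (x, k) (y, m)) =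
      (s : ℝ) ^ 4 * ind (D.CrossPair v w x y) +
      (s : ℝ) ^ 3 * (s - 1) / 2 *
        (ind (v = x) * ind (SameSide D (l v) v w y) + ind (v = y) * ind (SameSide D (l v) v w x) +
         ind (w = x) * ind (SameSide D (l w) w v y) + ind (w = y) * ind (SameSide D (l w) w v x)) +
      (s : ℝ) ^ 2 * (s - 1) ^ 2 / 2 *
        (ind (v = x) * (ind (w = y) * ind (G.Adj v w)) +
         ind (v = y) * (ind (w = x) * ind (G.Adj v w))) := by
  have hl : ∀ v w x y : V, ∑ i, ∑ j, ∑ k, ∑ m, ind (D'.CrossPair (w, i) (v, j) (x, k) (y, m)) =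
      ∑ i, ∑ j, ∑ k, ∑ m, ind (D'.CrossPair (v, i) (w, j) (x, k) (y, m)) := by
    intro v w x y
    rw [Finset.sum_comm]
    simp only [RectilinearDrawing.CrossPair.swap_left D' (v, _)]
  have hr : ∀ v w x y : V, ∑ i, ∑ j, ∑ k, ∑ m, ind (D'.CrossPair (v, i) (w, j) (y, k) (x, m)) =
      ∑ i, ∑ j, ∑ k, ∑ m, ind (D'.CrossPair (v, i) (w, j) (x, k) (y, m)) := by
    intro v w x y
    refine Finset.sum_congr rfl fun i _ => Finset.sum_congr rfl fun j _ => ?_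
    rw [Finset.sum_comm]
    simp only [RectilinearDrawing.CrossPair.swap_right D' _ _ (x, _)]
  have hn := fun a b c => ind_of_false (D.not_crossPair_of_common_endpoint a b c)
  by_cases hvw : G.Adj v w
  swap
  · have z : ∀ i j k m, ind (D'.CrossPair (v, i) (w, j) (x, k) (y, m)) = 0 := fun i j k m =>
      ind_of_false fun H => hvw H.1
    have hwv : ¬ G.Adj w v := fun H => hvw H.symm
    simp only [z]
    simp [SameSide, RectilinearDrawing.CrossPair, hvw, hwv, ind]
  by_cases hxy : G.Adj x y
  swap
  · have z : ∀ i j k m, ind (D'.CrossPair (v, i) (w, j) (x, k) (y, m)) = 0 := fun i j k m =>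
      ind_of_false fun H => hxy H.2.1
    have hyx : ¬ G.Adj y x := fun H => hxy H.symm
    have t1 : ind (v = x) * ind (SameSide D (l v) v w y) = 0 := by
      by_cases e : v = x
      · subst e; simp [SameSide, hxy, ind]
      · simp [ind, e]
    have t2 : ind (v = y) * ind (SameSide D (l v) v w x) = 0 := by
      by_cases e : v = y
      · subst e; simp [SameSide, hyx, ind]
      · simp [ind, e]
    have t3 : ind (w = x) * ind (SameSide D (l w) w v y) = 0 := by
      by_cases e : w = x
      · subst e; simp [SameSide, hxy, ind]
      · simp [ind, e]
    have t4 : ind (w = y) * ind (SameSide D (l w) w v x) = 0 := by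
      by_cases e : w = y
      · subst e; simp [SameSide, hyx, ind]
      · simp [ind, e]
    have t5 : ind (v = x) * (ind (w = y) * ind (G.Adj v w)) = 0 := by
      by_cases e : v = x ∧ w = y
      · obtain ⟨rfl, rfl⟩ := e; exact absurd hvw hxy
      · rw [← mul_assoc, ← ind_and, ind_of_false e, zero_mul]
    have t6 : ind (v = y) * (ind (w = x) * ind (G.Adj v w)) = 0 := by
      by_cases e : v = y ∧ w = x
      · obtain ⟨rfl, rfl⟩ := e; exact absurd hvw.symm hxy
      · rw [← mul_assoc, ← ind_and, ind_of_false e, zero_mul]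
    rw [t1, t2, t3, t4, t5, t6]
    simp only [z]
    simp [RectilinearDrawing.CrossPair, hxy, ind]
  have hvw' := hvw.ne
  have hxy' := hxy.ne
  by_cases e1 : v = x
  · subst e1
    by_cases e2 : w = y
    · subst e2
      rw [h.sum_crossPair_parallel hvw, hn]
      simp [ind, SameSide, hvw, hvw', hvw'.symm]
    · rw [h.sum_crossPair_adjacent hvw hxy e2, hn]
      simp [ind, SameSide, hvw, hxy, e2, hxy', hvw'.symm]
  by_cases e2 : v = y
  · subst e2
    rw [hr, ← ind_congr (RectilinearDrawing.CrossPair.swap_right D v w x v)]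
    by_cases e3 : w = x
    · subst e3
      rw [h.sum_crossPair_parallel hvw, hn]
      simp [ind, SameSide, hvw, hvw', hvw'.symm]
    · rw [h.sum_crossPair_adjacent hvw hxy.symm e3, hn]
      simp [ind, SameSide, hvw, hxy.symm, e1, e3, hvw'.symm]
  by_cases e3 : w = x
  · subst e3
    rw [hl, ← ind_congr (RectilinearDrawing.CrossPair.swap_left D v w w y),
      h.sum_crossPair_adjacent hvw.symm hxy e2, hn]
    simp [ind, SameSide, hvw.symm, hxy, e1, e2, hxy']
  by_cases e4 : w = y
  · subst e4
    rw [hl, hr, ← ind_congr (RectilinearDrawing.CrossPair.swap_left D v w x w),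
      ← ind_congr (RectilinearDrawing.CrossPair.swap_right D w v x w),
      h.sum_crossPair_adjacent hvw.symm hxy.symm e1, hn]
    simp [ind, SameSide, hvw.symm, hxy.symm, e1, e2, e3]
  rw [h.sum_crossPair_disjoint hvw' e1 e2 e3 e4 hxy']
  simp [ind, e1, e2, e3, e4]

/-! ### Summation over the seed. -/

theorem IsFlatlyPlanted.cr_eq {V : Type*} [Fintype V] {G : SimpleGraph V} [DecidableRel G.Adj]
    {s : ℕ} {D : RectilinearDrawing G} {l : V → DirectedLine}
    {D' : RectilinearDrawing (clusterGraph G s)} (h : IsFlatlyPlanted D l D')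
    (hl : ∀ v, IsHalvingLine D v (l v)) :
    (D'.cr : ℝ) = (D.cr : ℝ) * (s : ℝ) ^ 4
        + (∑ v : V, (((G.degree v / 2).choose 2 : ℝ) + (((G.degree v + 1) / 2).choose 2 : ℝ)))
            * ((s : ℝ) ^ 3 * ((s : ℝ) - 1) / 2)
        + (G.edgeSet.ncard : ℝ) * ((s : ℝ) ^ 2 * ((s : ℝ) - 1) ^ 2 / 4) := by
  set T := ∑ v : V, (((G.degree v / 2).choose 2 : ℝ) + (((G.degree v + 1) / 2).choose 2 : ℝ))
  have hT : ∑ v, ∑ w, ∑ u, ind (SameSide D (l v) v w u) = 2 * T := by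
    rw [Finset.mul_sum]
    exact Finset.sum_congr rfl fun v _ => sum_sum_ind_sameSide D (hl v)
  have hE := sum_sum_ind_adj G
  have t1 : ∑ v, ∑ w, ∑ x, ∑ y, ind (v = x) * ind (SameSide D (l v) v w y) = 2 * T := by
    rw [← hT]
    refine Finset.sum_congr rfl fun v _ => Finset.sum_congr rfl fun w _ => ?_
    simp only [← Finset.mul_sum, sum_ind_eq_mul]
  have t2 : ∑ v, ∑ w, ∑ x, ∑ y, ind (v = y) * ind (SameSide D (l v) v w x) = 2 * T := by
    rw [← hT]
    simp only [sum_ind_eq_mul]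
  have t3 : ∑ v, ∑ w, ∑ x, ∑ y, ind (w = x) * ind (SameSide D (l w) w v y) = 2 * T := by
    rw [← hT, Finset.sum_comm]
    refine Finset.sum_congr rfl fun v _ => Finset.sum_congr rfl fun w _ => ?_
    simp only [← Finset.mul_sum, sum_ind_eq_mul]
  have t4 : ∑ v, ∑ w, ∑ x, ∑ y, ind (w = y) * ind (SameSide D (l w) w v x) = 2 * T := by
    rw [← hT, Finset.sum_comm]
    simp only [sum_ind_eq_mul]
  have t5 : ∑ v, ∑ w, ∑ x, ∑ y, ind (v = x) * (ind (w = y) * ind (G.Adj v w)) =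
      2 * (G.edgeSet.ncard : ℝ) := by
    rw [← hE]
    simp only [← Finset.mul_sum, sum_ind_eq_mul]
  have t6 : ∑ v, ∑ w, ∑ x, ∑ y, ind (v = y) * (ind (w = x) * ind (G.Adj v w)) =
      2 * (G.edgeSet.ncard : ℝ) := by
    rw [← hE]
    simp only [sum_ind_eq_mul]
  have h8 := D'.eight_mul_cr
  rw [sum_prod_four] at h8
  simp only [h.sum_crossPair, Finset.sum_add_distrib, ← Finset.mul_sum] at h8
  simp only [← Finset.mul_sum] at t1 t2 t3 t4 t5 t6
  rw [← D.eight_mul_cr, t1, t2, t3, t4, t5, t6] at h8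
  -- The four coincidences of one end give `8 * T`, which cancels the `8`; the two coincidences of
  -- both ends give four times the number of edges, which turns the denominator `2` into `4`.
  linear_combination h8 / 8

theorem mainTheorem5 {V : Type*} [Fintype V] (G : SimpleGraph V) [DecidableRel G.Adj]
    (D : RectilinearDrawing G) (l : V → DirectedLine) (hl : ∀ v : V, IsHalvingLine D v (l v))
    (s : ℕ) :
    (∀ ε : ℝ, 0 < ε → ∃ D' : RectilinearDrawing (clusterGraph G s), IsPlantedWithin D l ε D') ∧
    ∃ ε : ℝ, 0 < ε ∧ ∀ D' : RectilinearDrawing (clusterGraph G s), IsPlantedWithin D l ε D' →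
      (D'.cr : ℝ) = (D.cr : ℝ) * (s : ℝ) ^ 4
        + (∑ v : V, (((G.degree v / 2).choose 2 : ℝ) + (((G.degree v + 1) / 2).choose 2 : ℝ)))
            * ((s : ℝ) ^ 3 * ((s : ℝ) - 1) / 2)
        + (G.edgeSet.ncard : ℝ) * ((s : ℝ) ^ 2 * ((s : ℝ) - 1) ^ 2 / 4) := by
  have hmem := fun v => (hl v).mem
  refine ⟨fun ε hε => exists_isPlantedWithin D l hmem s hε, ?_⟩
  obtain ⟨ε, hε, hpos⟩ := ((eventually_isFlatlyPlanted D l hmem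
    (fun v => (hl v).notMem) s).and self_mem_nhdsWithin).exists
  exact ⟨ε, hpos, fun D' hD' => (hε D' hD').cr_eq hl⟩
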